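/- Model and algorithm. Let $G=(V,E)$ be a finite graph with $n$ vertices, and let every vertex $v$ be given a maximum level $\ell_{\max}(v)\in\mathbb N$. In the synchronous full-duplex beeping model with two channels, in every round each vertex may send a signal on channel 1 and/or on channel 2 to all its neighbours, and then learns, for each channel separately, only whether at least one neighbour sent a signal on it. Every vertex $v$ holds a level $\ell(v)\in\{0,\dots,\ell_{\max}(v)\}$. In each round: * if $0<\ell(v)<\ell_{\max}(v)$, then $v$ signals on channel 1 with probability $2^{-\ell(v)}$, independently of everything else; otherwise it does not signal on channel 1; * $v$ signals on channel 2 if and only if $\ell(v)=0$; * then $v$ updates its level: if it received a signal on channel 2, $\ell(v)\gets\ell_{\max}(v)$; else if it received a signal on channel 1 and did not itself signal on channel 2, $\ell(v)\gets\min\{\ell(v)+1,\ell_{\max}(v)\}$; else if it signalled on channel 1, $\ell(v)\gets 0$; else if it did not signal on channel 2, $\ell(v)\gets\max\{\ell(v)-1,1\}$; else $\ell(v)$ is unchanged. Level $0$ means "in the MIS" and level $\ell_{\max}(v)$ means "not in the MIS". Let $\deg_2(v)$ be the maximum degree of the vertices in $N^+(v)=N(v)\cup\{v\}$, let $\log$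 be the logarithm to base 2, and put $\log 0:=0$ (relevant only for isolated vertices). Claim. For all constants $c_1\ge 15$, $c_2>0$ and $a>0$ there is a constant $M>0$ such that the following holds for every finite graph $G$ with $n$ vertices and all maximum levels with $$2\log\deg_2(v)+c_1\ \le\ \ell_{\max}(v)\ \le\ c_2\log n\qquad\text{for every }v\in V.$$ From every initial configuration with $0\le\ell_0(v)\le\ell_{\max}(v)$ for all $v$, with probability at least $1-n^{-a}$ the algorithm stabilizes to a maximal independent set within $M\log n$ rounds; that is, there is a maximal independent set $I$ of $G$ such that after every number $t\ge M\log n$ of rounds, every $v\in I$ has level $0$ and every $v\notin I$ has level $\ell_{\max}(v)$. -/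

import Mathlib

open MeasureTheory

namespace TwoChannelMIS

variable {V : Type*}

/-- The maximum degree of a vertex in the closed neighbourhood of `v`. -/
noncomputable def deg₂ [Fintype V] (G : SimpleGraph V) (v : V) : ℕ :=
  open Classical in (insert v (G.neighborFinset v)).sup fun u => G.degree u

/-- `v` signals on the first channel: only if `0 < ℓ v < ℓmax v`, and then exactly when its
fresh uniform random number `r v` in `[0, 1]` is below `2 ^ (-ℓ v)`. -/
def Beep₁ (ℓmax ℓ : V → ℕ) (r : V → unitInterval) (v : V) : Prop :=
  0 < ℓ v ∧ ℓ v < ℓmax v ∧ (r v : ℝ) < (1 / 2 : ℝ) ^ ℓ v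

/-- `v` signals on the second channel: exactly when its level is `0`. -/
def Beep₂ (ℓ : V → ℕ) (v : V) : Prop := ℓ v = 0

/-- `v` receives a signal: at least one neighbour sends it. -/
def Hears (G : SimpleGraph V) (sends : V → Prop) (v : V) : Prop := ∃ u, G.Adj v u ∧ sends u

open Classical in
/-- The local update rule of a vertex with maximum level `m` and level `l`, given which signals
it sent (`b₁`, `b₂`) and which it received (`h₁`, `h₂`). A vertex that signals on the second
channel keeps its level unless it receives a signal on the second channel. -/
noncomputable def update (m l : ℕ) (b₁ b₂ h₁ h₂ : Prop) : ℕ :=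
  if h₂ then m
  else if h₁ ∧ ¬ b₂ then min (l + 1) m
  else if b₁ then 0
  else if ¬ b₂ then max (l - 1) 1
  else l

/-- One synchronous round. -/
noncomputable def step (G : SimpleGraph V) (ℓmax ℓ : V → ℕ) (r : V → unitInterval) : V → ℕ :=
  fun v => update (ℓmax v) (ℓ v) (Beep₁ ℓmax ℓ r v) (Beep₂ ℓ v)
    (Hears G (Beep₁ ℓmax ℓ r) v) (Hears G (Beep₂ ℓ) v)

/-- The levels after `t` rounds, started from `ℓ₀`, with `ω t` the random numbers that the
vertices use in the round that leads from time `t` to time `t + 1`. -/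
noncomputable def level (G : SimpleGraph V) (ℓmax ℓ₀ : V → ℕ) (ω : ℕ → V → unitInterval) :
    ℕ → V → ℕ
  | 0 => ℓ₀
  | t + 1 => step G ℓmax (level G ℓmax ℓ₀ ω t) (ω t)

/-- The law of the random numbers: independent over rounds and vertices, each uniform on
`[0, 1]`. -/
noncomputable def randomness (V : Type*) [Fintype V] : Measure (ℕ → V → unitInterval) :=
  Measure.infinitePi fun _ : ℕ => Measure.pi fun _ : V => (volume : Measure unitInterval)

/-- At time `t` the levels `L` encode the set `I` (level `0` inside `I`, maximum level outside). -/
def Encodes (ℓmax : V → ℕ) (L : V → ℕ) (I : Set V) : Prop :=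
  (∀ v ∈ I, L v = 0) ∧ ∀ v ∉ I, L v = ℓmax v

/-- The trajectory `L` has stabilized to a maximal independent set by time `s`: one and the same
maximal independent set is encoded at all times from `s` on. -/
def StabilizedBy (G : SimpleGraph V) (ℓmax : V → ℕ) (L : ℕ → V → ℕ) (s : ℝ) : Prop :=
  ∃ I : Set V, Maximal G.IsIndepSet I ∧ ∀ t : ℕ, s ≤ t → Encodes ℓmax (L t) I

end TwoChannelMIS

/-! ### Independence over rounds, and the law of the signals in one round. -/

namespace TwoChannelMIS

/-! Call a vertex dominated if it or a neighbour has level 0. After any round no two adjacent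
vertices have level 0, and from then on zeros, hence domination, are permanent. Once every vertex is
dominated, the zero set is a maximal independent set, and one more round puts all other vertices at
their maximum level. By a union bound it suffices that a fixed `v` stays undominated for `T` rounds
with probability at most a polynomial in n times an exponentially small factor in `T`.

This follows from a potential. Let the load of `v` be the expected number of neighbours signalling
on channel 1, and let the progress measure be `(6/5) ^ ℓ v * (1 + 25 * load)`, set to 0 upon
domination. For undominated `v`, a round falls into one of two regimes. Either domination has
constant probability: a non-negligible share of the load comes from light neighbours, one of which
then signals alone (`prob_some_beeps_alone`), or `v` has level 1 and small load and signals alone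
itself. Or the progress measure contracts by 0.99 in expectation: a large load shrinks because its
carriers mostly hear signals and halve their probabilities, and under a small load the level of `v`
tends to fall.

In the first regime the progress measure can triple on failure. A sufficiently small power of it
decreases in expectation in both regimes (`integral_potential_next_le`): the power tames the factor
3, while concavity preserves the contraction. Iterating gives `prob_not_dominated_le`. -/

/-- Prepending an element to a sequence. -/
def consSeq {X : Type*} (q : X × (ℕ → X)) : ℕ → X
  | 0 => q.1
  | t + 1 => q.2 t

theorem measurable_consSeq {X : Type*} [MeasurableSpace X] :
    Measurable (consSeq : X × (ℕ → X) → ℕ → X) := by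
  refine measurable_pi_lambda _ fun t => ?_
  cases t with
  | zero => exact measurable_fst
  | succ t => exact (measurable_pi_apply t).comp measurable_snd

/-- Finite cylinders determine the infinite product. Padding one with `Set.univ` makes its index set
an initial segment, from which coordinate 0 splits off as a factor. -/
theorem map_consSeq_infinitePi {X : Type*} [MeasurableSpace X] (μ : Measure X)
    [IsProbabilityMeasure μ] :
    (μ.prod (Measure.infinitePi fun _ : ℕ => μ)).map consSeq =
      Measure.infinitePi fun _ : ℕ => μ := by
  refine Measure.eq_infinitePi _ fun s t ht => ?_
  obtain ⟨N, hN⟩ := s.exists_nat_subset_range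
  classical
  set t' : ℕ → Set X := fun i => if i ∈ s then t i else Set.univ with ht'
  have hmt' : ∀ i, MeasurableSet (t' i) := fun i => by
    simp only [ht']; split_ifs; exacts [ht i, MeasurableSet.univ]
  have hpre : consSeq ⁻¹' (Set.pi (s : Set ℕ) t) =
      t' 0 ×ˢ Set.pi ((Finset.range N : Finset ℕ) : Set ℕ) fun i => t' (i + 1) := by
    ext ⟨x, ω⟩
    simp only [Set.mem_preimage, Set.mem_pi, Finset.mem_coe, Set.mem_prod, ht']
    constructor
    · intro h
      refine ⟨?_, fun i _ => ?_⟩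
      · split_ifs with h0
        exacts [h 0 h0, trivial]
      · split_ifs with h0
        exacts [h (i + 1) h0, trivial]
    · rintro ⟨h0, h1⟩ i hi
      cases i with
      | zero => rw [if_pos hi] at h0; exact h0
      | succ i =>
        have := h1 i (Finset.mem_range.2 (by have := Finset.mem_range.1 (hN hi); omega))
        rw [if_pos hi] at this; exact this
  rw [Measure.map_apply measurable_consSeq (MeasurableSet.pi s.countable_toSet fun i _ => ht i),
    hpre, Measure.prod_prod, Measure.infinitePi_pi _ (fun i _ => hmt' (i + 1)), mul_comm,
    ← Finset.prod_range_succ' (fun i => μ (t' i)) N]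
  rw [← Finset.prod_subset (hN.trans (Finset.range_mono N.le_succ))
    (fun i _ hi => by simp [ht', hi])]
  exact Finset.prod_congr rfl fun i hi => by simp [ht', hi]

variable {V : Type*}

theorem level_consSeq (G : SimpleGraph V) (ℓmax ℓ : V → ℕ) (r : V → unitInterval)
    (ω : ℕ → V → unitInterval) (t : ℕ) :
    level G ℓmax ℓ (consSeq (r, ω)) (t + 1) = level G ℓmax (step G ℓmax ℓ r) ω t := by
  induction t with
  | zero => rfl
  | succ t ih => rw [level, ih]; rfl

/-- The levels after a round in which `b` is the set of vertices that signal on channel 1. -/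
noncomputable def next (G : SimpleGraph V) (ℓmax ℓ : V → ℕ) (b : V → Prop) : V → ℕ :=
  fun v => update (ℓmax v) (ℓ v) (b v) (Beep₂ ℓ v) (Hears G b v) (Hears G (Beep₂ ℓ) v)

theorem measurable_beep₁ (ℓmax ℓ : V → ℕ) : Measurable (Beep₁ ℓmax ℓ) := by
  refine measurable_pi_lambda _ fun v => ?_
  refine Measurable.and measurable_const (Measurable.and measurable_const ?_)
  exact measurableSet_setOfPred.1
    (measurableSet_lt (measurable_subtype_coe.comp (measurable_pi_apply v)) measurable_const)

/-- The probability that `v` signals on channel 1. -/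
noncomputable def beepProb (ℓmax ℓ : V → ℕ) (v : V) : ℝ :=
  if 0 < ℓ v ∧ ℓ v < ℓmax v then (1 / 2) ^ ℓ v else 0

theorem beepProb_nonneg (ℓmax ℓ : V → ℕ) (v : V) : 0 ≤ beepProb ℓmax ℓ v := by
  unfold beepProb; split_ifs <;> positivity

theorem beepProb_le_half (ℓmax ℓ : V → ℕ) (v : V) : beepProb ℓmax ℓ v ≤ 1 / 2 := by
  unfold beepProb
  split_ifs with h
  · calc ((1 : ℝ) / 2) ^ ℓ v ≤ (1 / 2) ^ 1 :=
        pow_le_pow_of_le_one (by norm_num) (by norm_num) h.1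
      _ = 1 / 2 := by norm_num
  · norm_num

theorem volume_beep (ℓmax ℓ : V → ℕ) (v : V) :
    (volume : Measure unitInterval).real
      {x | 0 < ℓ v ∧ ℓ v < ℓmax v ∧ (x : ℝ) < (1 / 2) ^ ℓ v} = beepProb ℓmax ℓ v := by
  unfold beepProb
  split_ifs with h
  · have h1 : ((1 : ℝ) / 2) ^ ℓ v ≤ 1 := pow_le_one₀ (by norm_num) (by norm_num)
    have : {x : unitInterval | 0 < ℓ v ∧ ℓ v < ℓmax v ∧ (x : ℝ) < (1 / 2) ^ ℓ v} =
        Set.Iio ⟨(1 / 2) ^ ℓ v, by positivity, h1⟩ := by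
      ext x; simp [h.1, h.2, ← Subtype.coe_lt_coe]
    rw [this, measureReal_def, unitInterval.volume_Iio, ENNReal.toReal_ofReal (by positivity)]
  · have : {x : unitInterval | 0 < ℓ v ∧ ℓ v < ℓmax v ∧ (x : ℝ) < (1 / 2) ^ ℓ v} = ∅ := by
      ext x; simp only [Set.mem_ofPred_eq, Set.mem_empty_iff_false, iff_false]; tauto
    rw [this, measureReal_empty]

variable [Fintype V]

theorem measurable_step (G : SimpleGraph V) (ℓmax ℓ : V → ℕ) : Measurable (step G ℓmax ℓ) :=
  (Measurable.of_discrete (f := next G ℓmax ℓ)).comp (measurable_beep₁ ℓmax ℓ)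

theorem measurable_level (G : SimpleGraph V) (ℓmax : V → ℕ) (t : ℕ) :
    Measurable fun q : (ℕ → V → unitInterval) × (V → ℕ) => level G ℓmax q.2 q.1 t := by
  induction t with
  | zero => exact measurable_snd
  | succ t ih =>
    have h : Measurable fun q : (V → unitInterval) × (V → ℕ) => step G ℓmax q.2 q.1 :=
      measurable_from_prod_countable_left fun ℓ => measurable_step G ℓmax ℓ
    exact h.comp (((measurable_pi_apply t).comp measurable_fst).prodMk ih)

/-- Conditioning on the first round. -/
theorem randomness_level_succ (G : SimpleGraph V) (ℓmax ℓ : V → ℕ) (t : ℕ) (S : Set (V → ℕ)) :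
    randomness V {ω | level G ℓmax ℓ ω (t + 1) ∈ S} =
      ∫⁻ r, randomness V {ω | level G ℓmax (step G ℓmax ℓ r) ω t ∈ S}
        ∂(Measure.pi fun _ : V => (volume : Measure unitInterval)) := by
  have hS : MeasurableSet S := S.to_countable.measurableSet
  have hm : MeasurableSet {ω | level G ℓmax ℓ ω (t + 1) ∈ S} :=
    ((measurable_level G ℓmax (t + 1)).comp (measurable_id.prodMk measurable_const)) hS
  have := map_consSeq_infinitePi (Measure.pi fun _ : V => (volume : Measure unitInterval))
  change (_ : Measure _).map consSeq = randomness V at this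
  rw [← this, Measure.map_apply measurable_consSeq hm,
    Measure.prod_apply (measurable_consSeq hm), this]
  refine lintegral_congr fun r => ?_
  change randomness V _ = _
  congr 1
  ext ω
  simp only [Set.mem_preimage, Set.mem_ofPred_eq, level_consSeq]

/-- The law of the set of vertices that signal on channel 1. -/
noncomputable def beepLaw (ℓmax ℓ : V → ℕ) : Measure (V → Prop) :=
  (Measure.pi fun _ : V => (volume : Measure unitInterval)).map (Beep₁ ℓmax ℓ)

instance (ℓmax ℓ : V → ℕ) : IsProbabilityMeasure (beepLaw ℓmax ℓ) :=
  Measure.isProbabilityMeasure_map (measurable_beep₁ ℓmax ℓ).aemeasurable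

open Classical in
theorem beepLaw_pattern (ℓmax ℓ : V → ℕ) {A S : Finset V} (h : Disjoint A S) :
    (beepLaw ℓmax ℓ).real {b | (∀ u ∈ A, b u) ∧ ∀ u ∈ S, ¬ b u} =
      (∏ u ∈ A, beepProb ℓmax ℓ u) * ∏ u ∈ S, (1 - beepProb ℓmax ℓ u) := by
  set B : V → Set unitInterval :=
    fun v => {x | 0 < ℓ v ∧ ℓ v < ℓmax v ∧ (x : ℝ) < (1 / 2) ^ ℓ v} with hB
  have hBm : ∀ v, MeasurableSet (B v) := fun v =>
    MeasurableSet.inter (MeasurableSet.const _) (MeasurableSet.inter (MeasurableSet.const _)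
      (measurableSet_lt measurable_subtype_coe measurable_const))
  have hpre : Beep₁ ℓmax ℓ ⁻¹' {b | (∀ u ∈ A, b u) ∧ ∀ u ∈ S, ¬ b u} =
      Set.pi Set.univ fun u => (if u ∈ A then B u else Set.univ) ∩
        (if u ∈ S then (B u)ᶜ else Set.univ) := by
    ext r
    simp only [Set.mem_preimage, Set.mem_ofPred_eq, Set.mem_pi, Set.mem_univ, true_imp_iff,
      Set.mem_inter_iff, forall_and]
    refine and_congr (forall_congr' fun u => ?_) (forall_congr' fun u => ?_)
    · split_ifs with hu <;> simp [hu, hB, Beep₁]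
    · split_ifs with hu <;> simp [hu, hB, Beep₁]
  rw [measureReal_def, beepLaw, Measure.map_apply (measurable_beep₁ ℓmax ℓ)
    (Set.to_countable _).measurableSet, hpre, Measure.pi_pi, ENNReal.toReal_prod,
    ← Finset.prod_ite_mem_eq A, ← Finset.prod_ite_mem_eq S, ← Finset.prod_mul_distrib]
  refine Finset.prod_congr rfl fun u _ => ?_
  have hv : (volume : Measure unitInterval).real (B u) = beepProb ℓmax ℓ u := volume_beep ℓmax ℓ u
  by_cases hA : u ∈ A
  · have hS : u ∉ S := Finset.disjoint_left.1 h hA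
    simp [hA, hS, ← hv, measureReal_def]
  · by_cases hS : u ∈ S
    · simp only [hA, hS, if_true, if_false, Set.univ_inter, one_mul]
      rw [← hv, ← probReal_compl_eq_one_sub (hBm u), measureReal_def]
    · simp [hA, hS]

end TwoChannelMIS

/-! ### Deterministic facts about one round: permanence of domination, change of signalling
probabilities. -/

namespace TwoChannelMIS

variable {V : Type*} {G : SimpleGraph V} {ℓmax ℓ : V → ℕ} {b : V → Prop} {u v : V}

/-- The vertex `v` or one of its neighbours has level `0`. -/
def Dominated (G : SimpleGraph V) (ℓ : V → ℕ) (v : V) : Prop := ℓ v = 0 ∨ Hears G (Beep₂ ℓ) v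

/-- No two adjacent vertices have level `0`. -/
def ZeroIndep (G : SimpleGraph V) (ℓ : V → ℕ) : Prop := ∀ u v, G.Adj u v → ℓ u = 0 → ℓ v ≠ 0

theorem next_of_hears₂ (h : Hears G (Beep₂ ℓ) v) : next G ℓmax ℓ b v = ℓmax v := by
  simp [next, update, h]

theorem next_of_zero (h : ¬ Hears G (Beep₂ ℓ) v) (h0 : ℓ v = 0) : next G ℓmax ℓ b v = 0 := by
  have : Beep₂ ℓ v := h0
  simp only [next, update, h, this, not_true_eq_false, and_false, if_false]
  split_ifs <;> simp [h0]

theorem next_of_hears₁ (h : ¬ Hears G (Beep₂ ℓ) v) (h0 : ℓ v ≠ 0) (hb : Hears G b v) :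
    next G ℓmax ℓ b v = min (ℓ v + 1) (ℓmax v) := by
  have : ¬ Beep₂ ℓ v := h0
  simp [next, update, h, this, hb]

theorem next_of_beep (h : ¬ Hears G (Beep₂ ℓ) v) (hb : b v) (hn : ¬ Hears G b v) :
    next G ℓmax ℓ b v = 0 := by
  simp [next, update, h, hb, hn]

theorem next_of_silent (h : ¬ Hears G (Beep₂ ℓ) v) (h0 : ℓ v ≠ 0) (hb : ¬ b v)
    (hn : ¬ Hears G b v) : next G ℓmax ℓ b v = max (ℓ v - 1) 1 := by
  have : ¬ Beep₂ ℓ v := h0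
  simp [next, update, h, this, hb, hn]

theorem next_le (hpos : ∀ v, 0 < ℓmax v) (hle : ∀ v, ℓ v ≤ ℓmax v) (v : V) :
    next G ℓmax ℓ b v ≤ ℓmax v := by
  have h1 := hpos v
  have h2 := hle v
  unfold next update
  split_ifs <;> omega

theorem le_next_succ (hle : ∀ v, ℓ v ≤ ℓmax v) (v : V) :
    next G ℓmax ℓ b v = 0 ∨ ℓ v ≤ next G ℓmax ℓ b v + 1 := by
  have h2 := hle v
  unfold next update
  split_ifs <;> omega

theorem next_le_succ (h : ¬ Dominated G ℓ v) : next G ℓmax ℓ b v ≤ ℓ v + 1 := by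
  have h' : ¬ Hears G (Beep₂ ℓ) v := fun h' => h (Or.inr h')
  have h0 : ℓ v ≠ 0 := fun h' => h (Or.inl h')
  simp only [next, update, if_neg h']
  split_ifs <;> omega

/-- No assumption on the initial levels is needed: a vertex ends at 0 only if it hears nothing on
channel 2 and either was at 0 or signalled alone on channel 1. Two neighbours cannot both satisfy
this. -/
theorem zeroIndep_next (hpos : ∀ v, 0 < ℓmax v) : ZeroIndep G (next G ℓmax ℓ b) := by
  have key : ∀ v, next G ℓmax ℓ b v = 0 →
      ¬ Hears G (Beep₂ ℓ) v ∧ (ℓ v ≠ 0 → b v ∧ ¬ Hears G b v) := by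
    intro v hv
    have h2 : ¬ Hears G (Beep₂ ℓ) v := fun h => by
      rw [next_of_hears₂ h] at hv; exact (hpos v).ne' hv
    refine ⟨h2, fun h0 => ?_⟩
    have h1 : ¬ Hears G b v := fun h => by
      rw [next_of_hears₁ h2 h0 h] at hv
      have := hpos v
      omega
    refine ⟨by_contra fun hb => ?_, h1⟩
    rw [next_of_silent h2 h0 hb h1] at hv
    omega
  intro u v huv hu hv
  obtain ⟨hu2, hu⟩ := key u hu
  obtain ⟨hv2, hv⟩ := key v hv
  have hu0 : ℓ u ≠ 0 := fun h => hv2 ⟨u, huv.symm, h⟩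
  have hv0 : ℓ v ≠ 0 := fun h => hu2 ⟨v, huv, h⟩
  exact (hv hv0).2 ⟨u, huv.symm, (hu hu0).1⟩

theorem ZeroIndep.not_hears (h : ZeroIndep G ℓ) (h0 : ℓ v = 0) : ¬ Hears G (Beep₂ ℓ) v := by
  rintro ⟨u, huv, hu⟩
  exact h v u huv h0 hu

theorem dominated_next (h : ZeroIndep G ℓ) (hv : Dominated G ℓ v) :
    Dominated G (next G ℓmax ℓ b) v := by
  rcases hv with hv | ⟨u, huv, hu⟩
  · exact Or.inl (next_of_zero (h.not_hears hv) hv)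
  · exact Or.inr ⟨u, huv, next_of_zero (h.not_hears hu) hu⟩

/-- Once every vertex is dominated, the next configuration encodes the zero set. -/
theorem encodes_next (h : ZeroIndep G ℓ) (hd : ∀ v, Dominated G ℓ v) :
    Encodes ℓmax (next G ℓmax ℓ b) {v | ℓ v = 0} :=
  ⟨fun _ hv => next_of_zero (h.not_hears hv) hv,
    fun v hv => next_of_hears₂ ((hd v).resolve_left hv)⟩

theorem Encodes.zeroSet {I : Set V} (hpos : ∀ v, 0 < ℓmax v) (h : Encodes ℓmax ℓ I) :
    {v | ℓ v = 0} = I := by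
  ext v
  refine ⟨fun hv => by_contra fun hI => ?_, fun hv => h.1 v hv⟩
  have := h.2 v hI
  exact (hpos v).ne' (this ▸ hv)

theorem maximal_zeroSet (h : ZeroIndep G ℓ) (hd : ∀ v, Dominated G ℓ v) :
    Maximal G.IsIndepSet {v | ℓ v = 0} := by
  refine ⟨fun u hu v hv _ huv => h u v huv hu hv, fun J hJ hsub v hv => ?_⟩
  rcases hd v with h0 | ⟨u, huv, hu⟩
  · exact h0
  · exact absurd huv (hJ hv (hsub hu) huv.ne)

/-- At time `T` a dominated vertex outside the zero set may still be at an intermediate level; the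
extra round in `hs` sends it to its maximum. -/
theorem stabilizedBy_of_dominated {L : ℕ → V → ℕ} {B : ℕ → V → Prop} {T : ℕ} {s : ℝ}
    (hpos : ∀ v, 0 < ℓmax v) (hL : ∀ t, L (t + 1) = next G ℓmax (L t) (B t))
    (h : ZeroIndep G (L T)) (hd : ∀ v, Dominated G (L T) v) (hs : (T : ℝ) + 1 ≤ s) :
    StabilizedBy G ℓmax L s := by
  set I : Set V := {v | L T v = 0} with hI
  have key : ∀ k, ZeroIndep G (L (T + k)) ∧ (∀ v, Dominated G (L (T + k)) v) ∧
      {v | L (T + k) v = 0} = I ∧ Encodes ℓmax (L (T + k + 1)) I := by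
    intro k
    induction k with
    | zero => exact ⟨h, hd, rfl, by rw [hL]; exact encodes_next h hd⟩
    | succ k ih =>
      obtain ⟨h1, h2, -, h4⟩ := ih
      have h1' : ZeroIndep G (L (T + (k + 1))) := by
        rw [← add_assoc, hL]; exact zeroIndep_next hpos
      have h2' : ∀ v, Dominated G (L (T + (k + 1))) v := fun v => by
        rw [← add_assoc, hL]; exact dominated_next h1 (h2 v)
      have h3' : {v | L (T + (k + 1)) v = 0} = I := h4.zeroSet hpos
      refine ⟨h1', h2', h3', ?_⟩
      rw [hL, ← h3']
      exact encodes_next h1' h2'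
  refine ⟨I, maximal_zeroSet h hd, fun t ht => ?_⟩
  have : T + 1 ≤ t := by exact_mod_cast hs.trans ht
  obtain ⟨k, rfl⟩ := Nat.exists_eq_add_of_le this
  have := (key k).2.2.2
  rwa [show T + k + 1 = T + 1 + k by omega] at this

theorem stabilizedBy_of_isEmpty [IsEmpty V] (L : ℕ → V → ℕ) (s : ℝ) :
    StabilizedBy G ℓmax L s :=
  ⟨∅, ⟨fun v => isEmptyElim v, fun _ _ _ v => isEmptyElim v⟩, fun _ _ =>
    ⟨fun v => isEmptyElim v, fun v => isEmptyElim v⟩⟩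

/-- Unless it drops to 0, a level falls by at most one, which at most doubles the probability. The
additive term covers a vertex at its maximum level, silent now, that re-enters one level below. -/
theorem beepProb_next_le (hle : ∀ v, ℓ v ≤ ℓmax v) (h0 : ℓ u ≠ 0) :
    beepProb ℓmax (next G ℓmax ℓ b) u ≤ 2 * beepProb ℓmax ℓ u + 2 * (1 / 2) ^ ℓmax u := by
  have hp := beepProb_nonneg ℓmax ℓ u
  by_cases h : 0 < next G ℓmax ℓ b u ∧ next G ℓmax ℓ b u < ℓmax u
  · have h1 : ℓ u ≤ next G ℓmax ℓ b u + 1 :=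
      (le_next_succ (G := G) (b := b) hle u).resolve_left h.1.ne'
    have h2 : ((1 : ℝ) / 2) ^ next G ℓmax ℓ b u ≤ 2 * (1 / 2) ^ ℓ u := by
      have := pow_le_pow_of_le_one (a := (1 : ℝ) / 2) (by norm_num) (by norm_num) h1
      rw [pow_succ] at this
      linarith
    rw [beepProb, if_pos h]
    rcases (hle u).lt_or_eq with h3 | h3
    · have h4 : (0 : ℝ) ≤ 2 * (1 / 2) ^ ℓmax u := by positivity
      have h5 : beepProb ℓmax ℓ u = (1 / 2) ^ ℓ u := if_pos ⟨Nat.pos_of_ne_zero h0, h3⟩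
      linarith
    · rw [h3] at h2
      linarith
  · rw [beepProb, if_neg h]
    positivity

theorem beepProb_next_of_hears (h0 : ℓ u ≠ 0) (hb : Hears G b u) :
    beepProb ℓmax (next G ℓmax ℓ b) u ≤ beepProb ℓmax ℓ u / 2 := by
  have hp := beepProb_nonneg ℓmax ℓ u
  by_cases h : 0 < next G ℓmax ℓ b u ∧ next G ℓmax ℓ b u < ℓmax u
  · have h2 : ¬ Hears G (Beep₂ ℓ) u := fun h2 => h.2.ne (next_of_hears₂ h2)
    have h3 := next_of_hears₁ (ℓmax := ℓmax) h2 h0 hb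
    have h4 : next G ℓmax ℓ b u = ℓ u + 1 := by omega
    have h5 : beepProb ℓmax ℓ u = (1 / 2) ^ ℓ u := if_pos ⟨Nat.pos_of_ne_zero h0, by omega⟩
    rw [beepProb, if_pos h, h4, h5, pow_succ]
    linarith
  · rw [beepProb, if_neg h]
    positivity

theorem beepProb_next_of_hears₂ (h : Hears G (Beep₂ ℓ) u) :
    beepProb ℓmax (next G ℓmax ℓ b) u = 0 := by
  rw [beepProb, next_of_hears₂ h, if_neg (by simp)]

end TwoChannelMIS

/-! ### Loads, lone signals and the chance of becoming dominated. -/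

namespace TwoChannelMIS

variable {V : Type*} {G : SimpleGraph V} {ℓmax ℓ : V → ℕ} {u v : V}

theorem prod_one_sub_le_exp (ℓmax ℓ : V → ℕ) (S : Finset V) :
    ∏ u ∈ S, (1 - beepProb ℓmax ℓ u) ≤ Real.exp (-∑ u ∈ S, beepProb ℓmax ℓ u) := by
  rw [← Finset.sum_neg_distrib, Real.exp_sum]
  refine Finset.prod_le_prod (fun u _ => ?_) fun u _ => Real.one_sub_le_exp_neg _
  linarith [beepProb_le_half ℓmax ℓ u]

/-- For `0 ≤ p ≤ 1/2` one has `(1 + 2p)(1 - p) ≥ 1`, so `1 - p ≥ exp (-2p)`. -/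
theorem exp_le_prod_one_sub (ℓmax ℓ : V → ℕ) (S : Finset V) :
    Real.exp (-(2 * ∑ u ∈ S, beepProb ℓmax ℓ u)) ≤ ∏ u ∈ S, (1 - beepProb ℓmax ℓ u) := by
  rw [Finset.mul_sum, ← Finset.sum_neg_distrib, Real.exp_sum]
  refine Finset.prod_le_prod (fun u _ => (Real.exp_pos _).le) fun u _ => ?_
  have h1 := beepProb_le_half ℓmax ℓ u
  have h0 := beepProb_nonneg ℓmax ℓ u
  have h2 := Real.add_one_le_exp (2 * beepProb ℓmax ℓ u)
  rw [Real.exp_neg, inv_le_comm₀ (Real.exp_pos _) (by linarith)]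
  refine le_trans ?_ h2
  rw [inv_le_iff_one_le_mul₀ (by linarith)]
  nlinarith

theorem prod_one_sub_nonneg (ℓmax ℓ : V → ℕ) (S : Finset V) :
    0 ≤ ∏ u ∈ S, (1 - beepProb ℓmax ℓ u) :=
  (Real.exp_pos _).le.trans (exp_le_prod_one_sub ℓmax ℓ S)

theorem one_sub_sum_le_prod_one_sub (ℓmax ℓ : V → ℕ) (S : Finset V) :
    1 - ∑ u ∈ S, beepProb ℓmax ℓ u ≤ ∏ u ∈ S, (1 - beepProb ℓmax ℓ u) := by
  classical
  induction S using Finset.induction_on with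
  | empty => simp
  | insert x S hx ih =>
    rw [Finset.prod_insert hx, Finset.sum_insert hx]
    have h0 := beepProb_nonneg ℓmax ℓ x
    have h1 := beepProb_le_half ℓmax ℓ x
    have h2 : 0 ≤ ∑ u ∈ S, beepProb ℓmax ℓ u :=
      Finset.sum_nonneg fun u _ => beepProb_nonneg ℓmax ℓ u
    nlinarith [mul_le_mul_of_nonneg_left ih (show 0 ≤ 1 - beepProb ℓmax ℓ x by linarith),
      mul_nonneg h0 h2]

variable [Fintype V]

theorem integrable_beepLaw (F : (V → Prop) → ℝ) : Integrable F (beepLaw ℓmax ℓ) :=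
  Integrable.of_finite

theorem integral_le_add_indicator {F H : (V → Prop) → ℝ} {S : Set (V → Prop)} {c : ℝ}
    (h : ∀ b, F b ≤ H b + S.indicator (fun _ => c) b) :
    ∫ b, F b ∂(beepLaw ℓmax ℓ) ≤ ∫ b, H b ∂(beepLaw ℓmax ℓ) + c * (beepLaw ℓmax ℓ).real S := by
  calc ∫ b, F b ∂(beepLaw ℓmax ℓ) ≤ ∫ b, (H b + S.indicator (fun _ => c) b) ∂(beepLaw ℓmax ℓ) :=
        integral_mono (integrable_beepLaw _) (integrable_beepLaw _) h
    _ = _ := by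
        rw [integral_add (integrable_beepLaw _) (integrable_beepLaw _),
          integral_indicator_const _ S.to_countable.measurableSet, smul_eq_mul, mul_comm c]

open Classical in
/-- The neighbours of a vertex. -/
noncomputable def nbrs (G : SimpleGraph V) (v : V) : Finset V := Finset.univ.filter (G.Adj v)

theorem mem_nbrs : u ∈ nbrs G v ↔ G.Adj v u := by simp [nbrs]

/-- The expected number of neighbours that signal on channel 1. -/
noncomputable def load (G : SimpleGraph V) (ℓmax ℓ : V → ℕ) (v : V) : ℝ :=
  ∑ u ∈ nbrs G v, beepProb ℓmax ℓ u

theorem load_nonneg (G : SimpleGraph V) (ℓmax ℓ : V → ℕ) (v : V) : 0 ≤ load G ℓmax ℓ v :=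
  Finset.sum_nonneg fun u _ => beepProb_nonneg ℓmax ℓ u

theorem prob_not_hears (u : V) :
    (beepLaw ℓmax ℓ).real {b | ¬ Hears G b u} = ∏ w ∈ nbrs G u, (1 - beepProb ℓmax ℓ w) := by
  have := beepLaw_pattern ℓmax ℓ (Finset.disjoint_empty_left (nbrs G u))
  rw [Finset.prod_empty, one_mul] at this
  rw [← this]
  congr 1
  ext b
  simp [Hears, mem_nbrs]

theorem prob_hears_le (v : V) : (beepLaw ℓmax ℓ).real {b | Hears G b v} ≤ load G ℓmax ℓ v := by
  have h : {b : V → Prop | Hears G b v} = {b | ¬ Hears G b v}ᶜ := by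
    ext b; simp
  rw [h, probReal_compl_eq_one_sub (Set.to_countable _).measurableSet, prob_not_hears]
  linarith [one_sub_sum_le_prod_one_sub ℓmax ℓ (nbrs G v), show load G ℓmax ℓ v =
    ∑ u ∈ nbrs G v, beepProb ℓmax ℓ u from rfl]

open Classical in
theorem prob_beep_alone (v : V) {S : Finset V} (hS : v ∉ S) :
    (beepLaw ℓmax ℓ).real {b | b v ∧ ¬ Hears G b v ∧ ∀ u ∈ S, ¬ b u} =
      beepProb ℓmax ℓ v * ∏ w ∈ nbrs G v ∪ S, (1 - beepProb ℓmax ℓ w) := by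
  have hd : Disjoint {v} (nbrs G v ∪ S) := by
    simp [mem_nbrs, hS]
  have := beepLaw_pattern ℓmax ℓ hd
  rw [Finset.prod_singleton] at this
  rw [← this]
  congr 1
  ext b
  simp only [Set.mem_ofPred_eq, Finset.mem_singleton, forall_eq, Finset.mem_union, mem_nbrs,
    Hears, not_exists, not_and, or_imp, forall_and]

/-- Among vertices of load at most `6`, one signals alone in its neighbourhood with probability at
least a constant times the probability that one of them signals. -/
theorem prob_some_beeps_alone (L : Finset V) (hL : ∀ u ∈ L, load G ℓmax ℓ u ≤ 6) :
    Real.exp (-12) * (1 - ∏ u ∈ L, (1 - beepProb ℓmax ℓ u)) ≤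
      (beepLaw ℓmax ℓ).real {b | ∃ u ∈ L, b u ∧ ¬ Hears G b u} := by
  classical
  induction L using Finset.induction_on with
  | empty => simp
  | insert x L hx ih =>
    have ih := ih fun u hu => hL u (Finset.mem_insert_of_mem hu)
    -- Requiring all of `L` to be silent makes the new event disjoint from the old one. Its
    -- probability is at least `exp (-12)` times the increment of `1 - ∏ (1 - p)` when `x` is
    -- inserted, so the bounds add up.
    have hsub : {b : V → Prop | ∃ u ∈ L, b u ∧ ¬ Hears G b u} ∪
        {b | b x ∧ ¬ Hears G b x ∧ ∀ u ∈ L, ¬ b u} ⊆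
        {b | ∃ u ∈ insert x L, b u ∧ ¬ Hears G b u} := by
      rintro b (⟨u, hu, h⟩ | ⟨h1, h2, -⟩)
      · exact ⟨u, Finset.mem_insert_of_mem hu, h⟩
      · exact ⟨x, Finset.mem_insert_self _ _, h1, h2⟩
    have hdisj : Disjoint {b : V → Prop | ∃ u ∈ L, b u ∧ ¬ Hears G b u}
        {b | b x ∧ ¬ Hears G b x ∧ ∀ u ∈ L, ¬ b u} := by
      rw [Set.disjoint_left]
      rintro b ⟨u, hu, h, -⟩ ⟨-, -, h'⟩
      exact h' u hu h
    refine le_trans ?_ (measureReal_mono hsub)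
    rw [measureReal_union hdisj (Set.to_countable _).measurableSet, prob_beep_alone x hx,
      Finset.prod_insert hx]
    have hN : Real.exp (-12) ≤ ∏ w ∈ nbrs G x, (1 - beepProb ℓmax ℓ w) := by
      refine le_trans ?_ (exp_le_prod_one_sub ℓmax ℓ _)
      have := hL x (Finset.mem_insert_self _ _)
      unfold load at this
      exact Real.exp_le_exp.2 (by linarith)
    have hU := Finset.prod_union_inter (s₁ := nbrs G x) (s₂ := L)
      (f := fun w => 1 - beepProb ℓmax ℓ w)
    have hI : ∏ w ∈ nbrs G x ∩ L, (1 - beepProb ℓmax ℓ w) ≤ 1 :=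
      Finset.prod_le_one (fun u _ => by linarith [beepProb_le_half ℓmax ℓ u])
        fun u _ => by linarith [beepProb_nonneg ℓmax ℓ u]
    have hP := prod_one_sub_nonneg ℓmax ℓ (nbrs G x ∪ L)
    have hPL := prod_one_sub_nonneg ℓmax ℓ L
    have hx0 := beepProb_nonneg ℓmax ℓ x
    have h1 : Real.exp (-12) * ∏ w ∈ L, (1 - beepProb ℓmax ℓ w) ≤
        ∏ w ∈ nbrs G x ∪ L, (1 - beepProb ℓmax ℓ w) := by
      nlinarith [mul_le_mul_of_nonneg_right hN hPL, mul_le_mul_of_nonneg_left hI hP]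
    nlinarith [mul_le_mul_of_nonneg_left h1 hx0]

/-- A neighbour that is not dominated and has load at most `6`. -/
def Light (G : SimpleGraph V) (ℓmax ℓ : V → ℕ) (u : V) : Prop :=
  ¬ Dominated G ℓ u ∧ load G ℓmax ℓ u ≤ 6

theorem exp_neg_six_le : Real.exp (-6) ≤ 1 / 250 := by
  rw [Real.exp_neg, show (6 : ℝ) = (6 : ℕ) * 1 by norm_num, Real.exp_nat_mul, one_div]
  refine inv_anti₀ (by norm_num) ?_
  calc (250 : ℝ) ≤ 2.7 ^ 6 := by norm_num
    _ ≤ Real.exp 1 ^ 6 :=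
      pow_le_pow_left₀ (by norm_num) (by linarith [Real.exp_one_gt_d9]) 6

theorem integral_beepProb_next_le (hle : ∀ v, ℓ v ≤ ℓmax v) (h0 : ℓ u ≠ 0) :
    ∫ b, beepProb ℓmax (next G ℓmax ℓ b) u ∂(beepLaw ℓmax ℓ) ≤
      2 * beepProb ℓmax ℓ u + 2 * (1 / 2) ^ ℓmax u := by
  have := integral_mono (μ := beepLaw ℓmax ℓ) (integrable_beepLaw _) (integrable_const _)
    fun b => beepProb_next_le (G := G) (b := b) hle h0
  simpa using this

/-- A dominated `u` of nonzero level falls silent. Otherwise the load of `u` exceeds 6, and `u`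
halves its probability except with chance `exp (-6) ≤ 1/250`; then `0.5 + 1.5/250 = 0.506`. -/
theorem integral_beepProb_next_le_of_not_light (hle : ∀ v, ℓ v ≤ ℓmax v) (h0 : ℓ u ≠ 0)
    (hu : ¬ Light G ℓmax ℓ u) :
    ∫ b, beepProb ℓmax (next G ℓmax ℓ b) u ∂(beepLaw ℓmax ℓ) ≤
      0.506 * beepProb ℓmax ℓ u + 2 * (1 / 2) ^ ℓmax u := by
  have hp := beepProb_nonneg ℓmax ℓ u
  have ha : (0 : ℝ) ≤ 2 * (1 / 2) ^ ℓmax u := by positivity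
  by_cases hd : Dominated G ℓ u
  · have h2 := hd.resolve_left h0
    simp only [beepProb_next_of_hears₂ h2, integral_zero]
    positivity
  · have hload : 6 < load G ℓmax ℓ u := not_le.1 fun h => hu ⟨hd, h⟩
    have hq : (beepLaw ℓmax ℓ).real {b | ¬ Hears G b u} ≤ 1 / 250 := by
      rw [prob_not_hears]
      refine (prod_one_sub_le_exp ℓmax ℓ _).trans (le_trans ?_ exp_neg_six_le)
      unfold load at hload
      exact Real.exp_le_exp.2 (by linarith)
    have := integral_le_add_indicator (ℓmax := ℓmax) (ℓ := ℓ)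
      (F := fun b => beepProb ℓmax (next G ℓmax ℓ b) u) (H := fun _ => beepProb ℓmax ℓ u / 2)
      (S := {b | ¬ Hears G b u}) (c := 1.5 * beepProb ℓmax ℓ u + 2 * (1 / 2) ^ ℓmax u) fun b => by
        by_cases hb : Hears G b u
        · rw [Set.indicator_of_notMem (by simpa using hb), add_zero]
          exact beepProb_next_of_hears h0 hb
        · rw [Set.indicator_of_mem (by simpa using hb)]
          linarith [beepProb_next_le (G := G) (b := b) hle h0]
    rw [integral_const, probReal_univ, one_smul] at this
    nlinarith [mul_le_mul_of_nonneg_left hq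
      (show 0 ≤ 1.5 * beepProb ℓmax ℓ u + 2 * (1 / 2) ^ ℓmax u by positivity)]

open Classical in
/-- The part of the load that comes from light neighbours. -/
noncomputable def lightLoad (G : SimpleGraph V) (ℓmax ℓ : V → ℕ) (v : V) : ℝ :=
  ∑ u ∈ (nbrs G v).filter (Light G ℓmax ℓ), beepProb ℓmax ℓ u

theorem level_ne_zero_of_mem_nbrs (hv : ¬ Dominated G ℓ v) (hu : u ∈ nbrs G v) : ℓ u ≠ 0 :=
  fun h => hv (Or.inr ⟨u, mem_nbrs.1 hu, h⟩)

theorem load_next_le (hle : ∀ v, ℓ v ≤ ℓmax v) (hv : ¬ Dominated G ℓ v)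
    (hA : ∑ u ∈ nbrs G v, 2 * ((1 : ℝ) / 2) ^ ℓmax u ≤ 1 / 16384) (b : V → Prop) :
    load G ℓmax (next G ℓmax ℓ b) v ≤ 2 * load G ℓmax ℓ v + 1 / 16384 := by
  refine le_trans (Finset.sum_le_sum fun u hu =>
    beepProb_next_le hle (level_ne_zero_of_mem_nbrs hv hu)) ?_
  rw [Finset.sum_add_distrib, ← Finset.mul_sum]
  unfold load
  linarith

theorem integral_load_next_le (hle : ∀ v, ℓ v ≤ ℓmax v) (hv : ¬ Dominated G ℓ v)
    (hA : ∑ u ∈ nbrs G v, 2 * ((1 : ℝ) / 2) ^ ℓmax u ≤ 1 / 16384) :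
    ∫ b, load G ℓmax (next G ℓmax ℓ b) v ∂(beepLaw ℓmax ℓ) ≤
      0.506 * load G ℓmax ℓ v + 1.5 * lightLoad G ℓmax ℓ v + 1 / 16384 := by
  classical
  simp only [load, lightLoad]
  rw [integral_finsetSum _ fun u _ => integrable_beepLaw _, Finset.sum_filter]
  -- Light neighbours may double their probability, which `0.506 + 1.5 ≥ 2` accommodates.
  have : ∀ u ∈ nbrs G v, ∫ b, beepProb ℓmax (next G ℓmax ℓ b) u ∂(beepLaw ℓmax ℓ) ≤
      0.506 * beepProb ℓmax ℓ u +
        1.5 * (if Light G ℓmax ℓ u then beepProb ℓmax ℓ u else 0) + 2 * (1 / 2) ^ ℓmax u := by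
    intro u hu
    have hp := beepProb_nonneg ℓmax ℓ u
    have h0 := level_ne_zero_of_mem_nbrs hv hu
    split_ifs with hl
    · linarith [integral_beepProb_next_le (G := G) hle h0]
    · linarith [integral_beepProb_next_le_of_not_light hle h0 hl]
  refine (Finset.sum_le_sum this).trans ?_
  rw [Finset.sum_add_distrib, Finset.sum_add_distrib, ← Finset.mul_sum, ← Finset.mul_sum]
  linarith

/-- A lower bound for the probability that an undominated vertex becomes dominated when its
neighbourhood is favourable. -/
noncomputable def dominationProb : ℝ := Real.exp (-12) * (1 - Real.exp (-(1 / 100000)))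

theorem dominationProb_pos : 0 < dominationProb := by
  have : Real.exp (-(1 / 100000)) < 1 := by rw [← Real.exp_zero]; exact Real.exp_lt_exp.2 (by norm_num)
  unfold dominationProb
  have := Real.exp_pos (-12)
  nlinarith

theorem dominationProb_le : dominationProb ≤ 1 / 4 := by
  have h1 : Real.exp (-12) ≤ 1 / 250 :=
    (Real.exp_le_exp.2 (by norm_num)).trans exp_neg_six_le
  have h2 := Real.exp_pos (-(1 / 100000))
  have h3 := Real.exp_pos (-12)
  unfold dominationProb
  nlinarith

theorem prob_dominated_of_lightLoad
    (h : 1 / 100000 ≤ lightLoad G ℓmax ℓ v) :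
    dominationProb ≤ (beepLaw ℓmax ℓ).real {b | Dominated G (next G ℓmax ℓ b) v} := by
  classical
  refine le_trans ?_ (measureReal_mono (s₁ := {b | ∃ u ∈ (nbrs G v).filter (Light G ℓmax ℓ),
    b u ∧ ¬ Hears G b u}) ?_)
  · refine le_trans ?_ (prob_some_beeps_alone _ fun u hu => (Finset.mem_filter.1 hu).2.2)
    refine mul_le_mul_of_nonneg_left (sub_le_sub_left ?_ _) (Real.exp_pos _).le
    refine (prod_one_sub_le_exp ℓmax ℓ _).trans (Real.exp_le_exp.2 (neg_le_neg ?_))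
    unfold lightLoad at h
    convert h
  · rintro b ⟨u, hu, hb, hn⟩
    rw [Finset.mem_filter, mem_nbrs] at hu
    exact Or.inr ⟨u, hu.1, next_of_beep (fun h => hu.2.1 (Or.inr h)) hb hn⟩

theorem prob_dominated_of_level_one (hv : ¬ Dominated G ℓ v) (h1 : ℓ v = 1) (hmax : 1 < ℓmax v)
    (h : load G ℓmax ℓ v ≤ 1 / 25) :
    dominationProb ≤ (beepLaw ℓmax ℓ).real {b | Dominated G (next G ℓmax ℓ b) v} := by
  classical
  refine le_trans ?_ (measureReal_mono (s₁ := {b | b v ∧ ¬ Hears G b v ∧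
    ∀ u ∈ (∅ : Finset V), ¬ b u}) ?_)
  · rw [prob_beep_alone v (by simp), Finset.union_empty]
    have hp : beepProb ℓmax ℓ v = 1 / 2 := by
      rw [beepProb, if_pos (by omega), h1, pow_one]
    have := one_sub_sum_le_prod_one_sub ℓmax ℓ (nbrs G v)
    unfold load at h
    rw [hp]
    linarith [dominationProb_le]
  · rintro b ⟨hb, hn, -⟩
    exact Or.inl (next_of_beep (fun h => hv (Or.inr h)) hb hn)

/-! ### The progress measure, the potential and their expected decrease. -/

/-- The local progress measure of the vertex `v`. -/
noncomputable def progress (G : SimpleGraph V) (ℓmax : V → ℕ) (v : V) (ℓ : V → ℕ) : ℝ :=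
  (6 / 5) ^ ℓ v * (1 + 25 * load G ℓmax ℓ v)

theorem one_le_progress (G : SimpleGraph V) (ℓmax : V → ℕ) (v : V) (ℓ : V → ℕ) :
    1 ≤ progress G ℓmax v ℓ := by
  have h1 : (1 : ℝ) ≤ (6 / 5) ^ ℓ v := one_le_pow₀ (by norm_num)
  have h2 := load_nonneg G ℓmax ℓ v
  unfold progress
  nlinarith

theorem progress_next_le_mul (hv : ¬ Dominated G ℓ v) (b : V → Prop) :
    progress G ℓmax v (next G ℓmax ℓ b) ≤
      (6 / 5) ^ (ℓ v + 1) * (1 + 25 * load G ℓmax (next G ℓmax ℓ b) v) := by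
  have h2 := load_nonneg G ℓmax (next G ℓmax ℓ b) v
  exact mul_le_mul_of_nonneg_right
    (pow_le_pow_right₀ (by norm_num) (next_le_succ hv)) (by linarith)

theorem progress_next_le (hle : ∀ v, ℓ v ≤ ℓmax v) (hv : ¬ Dominated G ℓ v)
    (hA : ∑ u ∈ nbrs G v, 2 * ((1 : ℝ) / 2) ^ ℓmax u ≤ 1 / 16384) (b : V → Prop) :
    progress G ℓmax v (next G ℓmax ℓ b) ≤ 3 * progress G ℓmax v ℓ := by
  have h1 := load_next_le hle hv hA b
  have h2 := load_nonneg G ℓmax ℓ v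
  have h3 : (0 : ℝ) < (6 / 5) ^ ℓ v := by positivity
  refine (progress_next_le_mul hv b).trans ?_
  rw [pow_succ, progress, mul_assoc, mul_left_comm 3]
  exact mul_le_mul_of_nonneg_left (by linarith) h3.le

open Classical in
/-- The progress measure, set to `0` once `v` is dominated. -/
noncomputable def aliveProgress (G : SimpleGraph V) (ℓmax : V → ℕ) (v : V) (ℓ : V → ℕ) : ℝ :=
  if Dominated G ℓ v then 0 else progress G ℓmax v ℓ

theorem aliveProgress_nonneg (G : SimpleGraph V) (ℓmax : V → ℕ) (v : V) (ℓ : V → ℕ) :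
    0 ≤ aliveProgress G ℓmax v ℓ := by
  unfold aliveProgress
  split_ifs
  exacts [le_rfl, zero_le_one.trans (one_le_progress G ℓmax v ℓ)]

theorem aliveProgress_le (G : SimpleGraph V) (ℓmax : V → ℕ) (v : V) (ℓ : V → ℕ) :
    aliveProgress G ℓmax v ℓ ≤ progress G ℓmax v ℓ := by
  unfold aliveProgress
  split_ifs
  exacts [zero_le_one.trans (one_le_progress G ℓmax v ℓ), le_rfl]

/-- Even if the level rises, the factor `6/5` is outweighed by the shrinking load: `1.2 * (1 + 15 d)
≤ 0.99 * (1 + 25 d)` for `d > 1/25`. -/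
theorem integral_aliveProgress_of_large_load (hv : ¬ Dominated G ℓ v)
    (hd : 1 / 25 < load G ℓmax ℓ v)
    (h : ∫ b, load G ℓmax (next G ℓmax ℓ b) v ∂(beepLaw ℓmax ℓ) ≤ 0.6 * load G ℓmax ℓ v) :
    ∫ b, aliveProgress G ℓmax v (next G ℓmax ℓ b) ∂(beepLaw ℓmax ℓ) ≤
      0.99 * progress G ℓmax v ℓ := by
  have h3 : (0 : ℝ) < (6 / 5) ^ ℓ v := by positivity
  refine (integral_mono (integrable_beepLaw _) (integrable_beepLaw _) fun b =>
    (aliveProgress_le _ _ _ _).trans (progress_next_le_mul hv b)).trans ?_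
  rw [integral_const_mul, integral_add (integrable_beepLaw _) (integrable_beepLaw _),
    integral_const, probReal_univ, one_smul, integral_const_mul, pow_succ, progress, mul_assoc,
    mul_left_comm 0.99]
  exact mul_le_mul_of_nonneg_left (by linarith) h3.le

/-- With probability at least `1 - d`, where `d` is the load, `v` hears nothing on channel 1, and
then it either joins the zero set or loses a level. The rare rise is charged with the worst-case
load `2 d + 1/16384`. -/
theorem integral_aliveProgress_of_small_load (hle : ∀ v, ℓ v ≤ ℓmax v) (hv : ¬ Dominated G ℓ v)
    (hA : ∑ u ∈ nbrs G v, 2 * ((1 : ℝ) / 2) ^ ℓmax u ≤ 1 / 16384)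
    (hd : load G ℓmax ℓ v ≤ 1 / 25) (h2 : 2 ≤ ℓ v)
    (h : ∫ b, load G ℓmax (next G ℓmax ℓ b) v ∂(beepLaw ℓmax ℓ) ≤ load G ℓmax ℓ v + 0.0011) :
    ∫ b, aliveProgress G ℓmax v (next G ℓmax ℓ b) ∂(beepLaw ℓmax ℓ) ≤
      0.99 * progress G ℓmax v ℓ := by
  -- Level at least 2 guarantees that a silent round really lowers it, since the update stops at 1.
  obtain ⟨k, hk⟩ := Nat.exists_eq_add_of_le' h2
  have hk0 : (0 : ℝ) < (6 / 5) ^ k := by positivity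
  have hd0 := load_nonneg G ℓmax ℓ v
  set d := load G ℓmax ℓ v with hdd
  have key := integral_le_add_indicator (ℓmax := ℓmax) (ℓ := ℓ)
    (F := fun b => aliveProgress G ℓmax v (next G ℓmax ℓ b))
    (H := fun b => (6 / 5) ^ (k + 1) * (1 + 25 * load G ℓmax (next G ℓmax ℓ b) v))
    (S := {b | Hears G b v})
    (c := (6 / 5) ^ (k + 3) * (1 + 25 * (2 * d + 1 / 16384))) fun b => by
      have hb0 := load_nonneg G ℓmax (next G ℓmax ℓ b) v
      by_cases hb : Hears G b v
      · rw [Set.indicator_of_mem (by simpa using hb)]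
        have h1 := (aliveProgress_le G ℓmax v _).trans (progress_next_le_mul (ℓmax := ℓmax) hv b)
        have h4 := load_next_le hle hv hA b
        rw [hk] at h1
        have h5 : ((6 : ℝ) / 5) ^ (k + 2 + 1) * (1 + 25 * load G ℓmax (next G ℓmax ℓ b) v) ≤
            (6 / 5) ^ (k + 3) * (1 + 25 * (2 * d + 1 / 16384)) :=
          mul_le_mul_of_nonneg_left (by linarith) (by positivity)
        have h6 : (0 : ℝ) ≤ (6 / 5) ^ (k + 1) * (1 + 25 * load G ℓmax (next G ℓmax ℓ b) v) := by
          positivity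
        linarith
      · rw [Set.indicator_of_notMem (by simpa using hb), add_zero]
        by_cases hdom : Dominated G (next G ℓmax ℓ b) v
        · rw [aliveProgress, if_pos hdom]
          positivity
        · rw [aliveProgress, if_neg hdom, progress]
          have hbv : ¬ b v := fun hbv =>
            hdom (Or.inl (next_of_beep (fun h => hv (Or.inr h)) hbv hb))
          have : next G ℓmax ℓ b v = k + 1 := by
            rw [next_of_silent (fun h => hv (Or.inr h)) (by omega) hbv hb, hk]
            omega
          rw [this]
  rw [integral_const_mul, integral_add (integrable_beepLaw _) (integrable_beepLaw _),
    integral_const, probReal_univ, one_smul, integral_const_mul] at key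
  have hS := prob_hears_le (G := G) (ℓmax := ℓmax) (ℓ := ℓ) v
  have hc : (6 / 5) ^ (k + 3) * (1 + 25 * (2 * d + 1 / 16384)) *
      (beepLaw ℓmax ℓ).real {b | Hears G b v} ≤
      (6 / 5) ^ (k + 3) * (1 + 25 * (2 * d + 1 / 16384)) * d :=
    mul_le_mul_of_nonneg_left hS (by positivity)
  have hm : (6 / 5 : ℝ) ^ (k + 1) *
      (1 + 25 * ∫ b, load G ℓmax (next G ℓmax ℓ b) v ∂(beepLaw ℓmax ℓ)) ≤
      (6 / 5) ^ (k + 1) * (1 + 25 * (d + 0.0011)) :=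
    mul_le_mul_of_nonneg_left (by linarith) (by positivity)
  refine (key.trans (add_le_add hm hc)).trans ?_
  rw [progress, hk, ← hdd]
  have e1 : (6 / 5 : ℝ) ^ (k + 1) = (6 / 5) ^ k * (6 / 5) := by ring
  have e2 : (6 / 5 : ℝ) ^ (k + 2) = (6 / 5) ^ k * (36 / 25) := by ring
  have e3 : (6 / 5 : ℝ) ^ (k + 3) = (6 / 5) ^ k * (216 / 125) := by ring
  rw [e1, e2, e3]
  have : 6 / 5 * (1 + 25 * (d + 0.0011)) + 216 / 125 * (1 + 25 * (2 * d + 1 / 16384)) * d ≤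
      0.99 * (36 / 25 * (1 + 25 * d)) := by
    nlinarith [mul_le_mul_of_nonneg_left hd hd0]
  nlinarith [mul_le_mul_of_nonneg_left this hk0.le]

theorem rpow_le_tangent {x β : ℝ} (hx : 0 ≤ x) (h0 : 0 ≤ β) (h1 : β ≤ 1) :
    x ^ β ≤ 1 + β * (x - 1) := by
  have := rpow_one_add_le_one_add_mul_self (s := x - 1) (by linarith) h0 h1
  rwa [add_sub_cancel] at this

/-- The exponent that turns the progress measure into a supermartingale. -/
noncomputable def progressExp : ℝ := dominationProb / 4

/-- The rate at which the potential decreases. -/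
noncomputable def decayRate : ℝ := dominationProb / 400

/-- The potential of the vertex `v`. -/
noncomputable def potential (G : SimpleGraph V) (ℓmax : V → ℕ) (v : V) (ℓ : V → ℕ) : ℝ :=
  aliveProgress G ℓmax v ℓ ^ progressExp

theorem progressExp_pos : 0 < progressExp := by
  have := dominationProb_pos
  unfold progressExp; positivity

theorem progressExp_le_one : progressExp ≤ 1 := by
  have := dominationProb_le
  unfold progressExp; linarith

theorem potential_nonneg (G : SimpleGraph V) (ℓmax : V → ℕ) (v : V) (ℓ : V → ℕ) :
    0 ≤ potential G ℓmax v ℓ := Real.rpow_nonneg (aliveProgress_nonneg G ℓmax v ℓ) _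

theorem potential_of_dominated (h : Dominated G ℓ v) : potential G ℓmax v ℓ = 0 := by
  rw [potential, aliveProgress, if_pos h, Real.zero_rpow progressExp_pos.ne']

theorem one_le_potential (h : ¬ Dominated G ℓ v) : 1 ≤ potential G ℓmax v ℓ := by
  rw [potential, aliveProgress, if_neg h]
  exact Real.one_le_rpow (one_le_progress G ℓmax v ℓ) progressExp_pos.le

theorem potential_le_progress (G : SimpleGraph V) (ℓmax : V → ℕ) (v : V) (ℓ : V → ℕ) :
    potential G ℓmax v ℓ ≤ progress G ℓmax v ℓ := by
  have h1 := one_le_progress G ℓmax v ℓ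
  calc potential G ℓmax v ℓ ≤ progress G ℓmax v ℓ ^ progressExp :=
        Real.rpow_le_rpow (aliveProgress_nonneg G ℓmax v ℓ) (aliveProgress_le G ℓmax v ℓ)
          progressExp_pos.le
    _ ≤ progress G ℓmax v ℓ ^ (1 : ℝ) := Real.rpow_le_rpow_of_exponent_le h1 progressExp_le_one
    _ = _ := Real.rpow_one _

/-- Domination kills the potential; on failure it grows by at most `3 ^ progressExp`, which the
small exponent keeps below the gain. -/
theorem integral_potential_of_prob_dominated (hle : ∀ v, ℓ v ≤ ℓmax v) (hv : ¬ Dominated G ℓ v)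
    (hA : ∑ u ∈ nbrs G v, 2 * ((1 : ℝ) / 2) ^ ℓmax u ≤ 1 / 16384)
    (h : dominationProb ≤ (beepLaw ℓmax ℓ).real {b | Dominated G (next G ℓmax ℓ b) v}) :
    ∫ b, potential G ℓmax v (next G ℓmax ℓ b) ∂(beepLaw ℓmax ℓ) ≤
      (1 - decayRate) * potential G ℓmax v ℓ := by
  have hp1 := one_le_progress G ℓmax v ℓ
  have hY : potential G ℓmax v ℓ = progress G ℓmax v ℓ ^ progressExp := by
    rw [potential, aliveProgress, if_neg hv]
  have hY1 := one_le_potential (ℓmax := ℓmax) hv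
  have h3 : (3 : ℝ) ^ progressExp ≤ 1 + 2 * progressExp := by
    linarith [rpow_le_tangent (x := 3) (by norm_num) progressExp_pos.le progressExp_le_one]
  have h30 : (0 : ℝ) ≤ 3 ^ progressExp := by positivity
  have key := integral_le_add_indicator (ℓmax := ℓmax) (ℓ := ℓ)
    (F := fun b => potential G ℓmax v (next G ℓmax ℓ b)) (H := fun _ => 0)
    (S := {b | Dominated G (next G ℓmax ℓ b) v}ᶜ)
    (c := 3 ^ progressExp * potential G ℓmax v ℓ) fun b => by
      by_cases hb : Dominated G (next G ℓmax ℓ b) v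
      · rw [Set.indicator_of_notMem (by simpa using hb), potential_of_dominated hb, add_zero]
      · rw [Set.indicator_of_mem (by simpa using hb), zero_add, hY,
          ← Real.mul_rpow (by norm_num) (by linarith)]
        exact Real.rpow_le_rpow (aliveProgress_nonneg _ _ _ _)
          ((aliveProgress_le _ _ _ _).trans (progress_next_le hle hv hA b)) progressExp_pos.le
  rw [integral_zero, zero_add,
    probReal_compl_eq_one_sub (Set.to_countable _).measurableSet] at key
  refine key.trans ?_
  rw [mul_right_comm]
  refine mul_le_mul_of_nonneg_right ?_ (by linarith)
  have hk := dominationProb_pos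
  have hk' := dominationProb_le
  calc (3 : ℝ) ^ progressExp * (1 - (beepLaw ℓmax ℓ).real {b | Dominated G (next G ℓmax ℓ b) v})
      ≤ 3 ^ progressExp * (1 - dominationProb) := by gcongr
    _ ≤ (1 + 2 * progressExp) * (1 - dominationProb) := by
        refine mul_le_mul_of_nonneg_right h3 (by linarith)
    -- With `κ = dominationProb`, `(1 + κ/2) * (1 - κ) ≤ 1 - κ/2`, with room to spare.
    _ ≤ 1 - decayRate := by unfold progressExp decayRate; nlinarith

/-- The tangent at 1 bounds the concave power from above, so a contraction by 0.99 becomes one by `1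
- 0.01 * progressExp`, which is exactly `1 - decayRate`. -/
theorem integral_potential_of_integral_aliveProgress (hv : ¬ Dominated G ℓ v)
    (h : ∫ b, aliveProgress G ℓmax v (next G ℓmax ℓ b) ∂(beepLaw ℓmax ℓ) ≤
      0.99 * progress G ℓmax v ℓ) :
    ∫ b, potential G ℓmax v (next G ℓmax ℓ b) ∂(beepLaw ℓmax ℓ) ≤
      (1 - decayRate) * potential G ℓmax v ℓ := by
  set Y := progress G ℓmax v ℓ with hYdef
  have hp1 : 1 ≤ Y := one_le_progress G ℓmax v ℓ
  have hY : potential G ℓmax v ℓ = Y ^ progressExp := by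
    rw [potential, aliveProgress, if_neg hv]
  have hYpos : 0 < Y ^ progressExp := Real.rpow_pos_of_pos (by linarith) _
  have hpt : ∀ b, potential G ℓmax v (next G ℓmax ℓ b) ≤ Y ^ progressExp *
      (1 - progressExp + progressExp / Y * aliveProgress G ℓmax v (next G ℓmax ℓ b)) := by
    intro b
    have h0 := aliveProgress_nonneg G ℓmax v (next G ℓmax ℓ b)
    have h1 : potential G ℓmax v (next G ℓmax ℓ b) =
        Y ^ progressExp * (aliveProgress G ℓmax v (next G ℓmax ℓ b) / Y) ^ progressExp := by
      rw [← Real.mul_rpow (by linarith) (by positivity), mul_div_cancel₀ _ (by linarith)]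
      rfl
    rw [h1]
    refine mul_le_mul_of_nonneg_left ?_ hYpos.le
    refine (rpow_le_tangent (by positivity) progressExp_pos.le progressExp_le_one).trans_eq ?_
    ring
  refine (integral_mono (integrable_beepLaw _) (integrable_beepLaw _) hpt).trans ?_
  rw [integral_const_mul, integral_add (integrable_beepLaw _) (integrable_beepLaw _),
    integral_const, probReal_univ, one_smul, integral_const_mul, hY, mul_comm (1 - decayRate)]
  refine mul_le_mul_of_nonneg_left ?_ hYpos.le
  have hβ := progressExp_pos
  have : progressExp / Y * ∫ b, aliveProgress G ℓmax v (next G ℓmax ℓ b) ∂(beepLaw ℓmax ℓ) ≤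
      progressExp / Y * (0.99 * Y) := mul_le_mul_of_nonneg_left h (by positivity)
  have e : progressExp / Y * (0.99 * Y) = 0.99 * progressExp := by
    field_simp
  have e' : decayRate = 0.01 * progressExp := by unfold decayRate progressExp; ring
  linarith

/-- The potential decreases in expectation by a constant factor in every round. -/
theorem integral_potential_next_le (hpos : ∀ v, 1 < ℓmax v) (hle : ∀ v, ℓ v ≤ ℓmax v)
    (hz : ZeroIndep G ℓ)
    (hA : ∑ u ∈ nbrs G v, 2 * ((1 : ℝ) / 2) ^ ℓmax u ≤ 1 / 16384) :
    ∫ b, potential G ℓmax v (next G ℓmax ℓ b) ∂(beepLaw ℓmax ℓ) ≤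
      (1 - decayRate) * potential G ℓmax v ℓ := by
  by_cases hv : Dominated G ℓ v
  · simp [potential_of_dominated hv, potential_of_dominated (dominated_next hz hv)]
  have hd0 := load_nonneg G ℓmax ℓ v
  have hE := integral_load_next_le hle hv hA
  -- Here the light load is at least `1/1000 * 1/100`, the threshold behind `dominationProb`.
  by_cases hg : 1 / 1000 ≤ load G ℓmax ℓ v ∧ 1 / 100 * load G ℓmax ℓ v ≤ lightLoad G ℓmax ℓ v
  · exact integral_potential_of_prob_dominated hle hv hA
      (prob_dominated_of_lightLoad (by linarith [hg.1, hg.2]))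
  -- `0.506 + 1.5/100 + 1000/16384 < 0.6`: the load is large enough to absorb the additive error.
  have h6 : 1 / 1000 ≤ load G ℓmax ℓ v →
      ∫ b, load G ℓmax (next G ℓmax ℓ b) v ∂(beepLaw ℓmax ℓ) ≤ 0.6 * load G ℓmax ℓ v := by
    intro h
    have : lightLoad G ℓmax ℓ v < 1 / 100 * load G ℓmax ℓ v := not_le.1 fun h' => hg ⟨h, h'⟩
    linarith
  rcases lt_or_ge (1 / 25) (load G ℓmax ℓ v) with hl | hl
  · exact integral_potential_of_integral_aliveProgress hv
      (integral_aliveProgress_of_large_load hv hl (h6 (by linarith)))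
  by_cases h1 : ℓ v = 1
  · exact integral_potential_of_prob_dominated hle hv hA
      (prob_dominated_of_level_one hv h1 (hpos v) hl)
  have h0 : ℓ v ≠ 0 := fun h => hv (Or.inl h)
  refine integral_potential_of_integral_aliveProgress hv
    (integral_aliveProgress_of_small_load hle hv hA hl (by omega) ?_)
  rcases le_or_gt (1 / 1000) (load G ℓmax ℓ v) with h | h
  · linarith [h6 h]
  -- A load below `1/1000` may double, but this adds less than `1/1000 + 1/16384 < 0.0011`.
  · have := integral_mono (μ := beepLaw ℓmax ℓ) (integrable_beepLaw _) (integrable_const _)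
      (load_next_le hle hv hA)
    rw [integral_const, probReal_univ, one_smul] at this
    linarith

end TwoChannelMIS

/-! ### Iteration over rounds, numerical bounds and the union bound. -/

namespace TwoChannelMIS

variable {V : Type*} [Fintype V] {G : SimpleGraph V} {ℓmax ℓ : V → ℕ} {u v : V}

theorem decayRate_pos : 0 < decayRate := by
  have := dominationProb_pos
  unfold decayRate; positivity

theorem decayRate_le_one : decayRate ≤ 1 := by
  have := dominationProb_le
  unfold decayRate; linarith

instance : IsProbabilityMeasure (randomness V) := by
  unfold randomness; infer_instance

theorem lintegral_potential_step (v : V) :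
    ∫⁻ r, ENNReal.ofReal (potential G ℓmax v (step G ℓmax ℓ r))
        ∂(Measure.pi fun _ : V => (volume : Measure unitInterval)) =
      ENNReal.ofReal (∫ b, potential G ℓmax v (next G ℓmax ℓ b) ∂(beepLaw ℓmax ℓ)) := by
  rw [ofReal_integral_eq_lintegral_ofReal (integrable_beepLaw _)
    (Filter.Eventually.of_forall fun b => potential_nonneg _ _ _ _), beepLaw,
    lintegral_map Measurable.of_discrete (measurable_beep₁ ℓmax ℓ)]
  rfl

/-- Induction on `t` over all starting levels, conditioning on the first round. The base case is
that the potential is at least 1 while `v` is undominated. -/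
theorem prob_not_dominated_le (hpos : ∀ v, 1 < ℓmax v)
    (hA : ∑ u ∈ nbrs G v, 2 * ((1 : ℝ) / 2) ^ ℓmax u ≤ 1 / 16384) (t : ℕ) :
    ∀ ℓ : V → ℕ, (∀ v, ℓ v ≤ ℓmax v) → ZeroIndep G ℓ →
      randomness V {ω | ¬ Dominated G (level G ℓmax ℓ ω t) v} ≤
        ENNReal.ofReal ((1 - decayRate) ^ t * potential G ℓmax v ℓ) := by
  have hpos' : ∀ v, 0 < ℓmax v := fun v => zero_lt_one.trans (hpos v)
  have hη : 0 ≤ 1 - decayRate := by linarith [decayRate_le_one]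
  induction t with
  | zero =>
    intro ℓ _ _
    by_cases h : Dominated G ℓ v
    · have : {ω : ℕ → V → unitInterval | ¬ Dominated G (level G ℓmax ℓ ω 0) v} = ∅ := by
        ext ω; simp [level, h]
      simp [this]
    · refine prob_le_one.trans ?_
      rw [pow_zero, one_mul, ← ENNReal.ofReal_one]
      exact ENNReal.ofReal_le_ofReal (one_le_potential h)
  | succ t ih =>
    intro ℓ hle hz
    refine (randomness_level_succ G ℓmax ℓ t {L | ¬ Dominated G L v}).trans_le ?_
    refine (lintegral_mono fun r => ih (step G ℓmax ℓ r) (next_le hpos' hle)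
      (zeroIndep_next hpos')).trans ?_
    simp_rw [ENNReal.ofReal_mul (pow_nonneg hη t)]
    rw [lintegral_const_mul' _ _ ENNReal.ofReal_ne_top, lintegral_potential_step,
      ← ENNReal.ofReal_mul (pow_nonneg hη t), pow_succ, mul_assoc]
    exact ENNReal.ofReal_le_ofReal (mul_le_mul_of_nonneg_left
      (integral_potential_next_le hpos hle hz hA) (pow_nonneg hη t))

theorem progress_le (hle : ∀ v, ℓ v ≤ ℓmax v) (v : V) :
    progress G ℓmax v ℓ ≤ (6 / 5) ^ ℓmax v * (1 + 25 * Fintype.card V) := by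
  have h1 : load G ℓmax ℓ v ≤ Fintype.card V := by
    refine (Finset.sum_le_card_nsmul _ _ 1 fun u _ =>
      (beepProb_le_half ℓmax ℓ u).trans (by norm_num)).trans ?_
    rw [nsmul_one]
    exact_mod_cast Finset.card_le_univ _
  have h2 := load_nonneg G ℓmax ℓ v
  have h3 := pow_le_pow_right₀ (show (1 : ℝ) ≤ 6 / 5 by norm_num) (hle v)
  unfold progress
  gcongr

/-- The first round is spent on reaching `ZeroIndep` from arbitrary levels; afterwards the potential
is bounded by its crude maximum. -/
theorem prob_not_dominated_succ_le (hpos : ∀ v, 1 < ℓmax v) (hle : ∀ v, ℓ v ≤ ℓmax v)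
    (hA : ∑ u ∈ nbrs G v, 2 * ((1 : ℝ) / 2) ^ ℓmax u ≤ 1 / 16384) (t : ℕ) :
    randomness V {ω | ¬ Dominated G (level G ℓmax ℓ ω (t + 1)) v} ≤
      ENNReal.ofReal ((1 - decayRate) ^ t *
        ((6 / 5) ^ ℓmax v * (1 + 25 * Fintype.card V))) := by
  have hpos' : ∀ v, 0 < ℓmax v := fun v => zero_lt_one.trans (hpos v)
  have hη : 0 ≤ 1 - decayRate := by linarith [decayRate_le_one]
  refine (randomness_level_succ G ℓmax ℓ t {L | ¬ Dominated G L v}).trans_le ?_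
  have hb : ∀ r : V → unitInterval,
      randomness V {ω | level G ℓmax (step G ℓmax ℓ r) ω t ∈ {L | ¬ Dominated G L v}} ≤
        ENNReal.ofReal ((1 - decayRate) ^ t *
          ((6 / 5) ^ ℓmax v * (1 + 25 * Fintype.card V))) := fun r => by
    have hle' : ∀ v, step G ℓmax ℓ r v ≤ ℓmax v := next_le hpos' hle
    refine (prob_not_dominated_le hpos hA t (step G ℓmax ℓ r) hle'
      (zeroIndep_next hpos')).trans (ENNReal.ofReal_le_ofReal ?_)
    exact mul_le_mul_of_nonneg_left ((potential_le_progress _ _ _ _).trans (progress_le hle' v))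
      (pow_nonneg hη t)
  refine (lintegral_mono hb).trans ?_
  simp

theorem logb_natCast_nonneg (k : ℕ) : 0 ≤ Real.logb 2 k := by
  rcases k.eq_zero_or_pos with rfl | h
  · simp
  · exact Real.logb_nonneg (by norm_num) (by exact_mod_cast h)

theorem card_nbrs_le_deg₂ (h : u ∈ nbrs G v) : (nbrs G v).card ≤ deg₂ G u := by
  classical
  have hv : v ∈ insert u (G.neighborFinset u) := by
    rw [Finset.mem_insert, SimpleGraph.mem_neighborFinset]
    exact Or.inr (mem_nbrs.1 h).symm
  have h1 : (nbrs G v).card = G.degree v := by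
    rw [← SimpleGraph.card_neighborFinset_eq_degree]
    congr 1
    ext w
    simp [mem_nbrs]
  rw [h1, deg₂]
  convert Finset.le_sup (f := fun u => G.degree u) hv

/-- Each neighbour `u` of `v` has `v` in its closed neighbourhood, so `deg₂ G u` is at least the
degree of `v`. Each summand is then at most `2 * 2 ^ (-15)` divided by that degree. -/
theorem sum_pow_maxLevel_le {c₁ : ℝ} (hc₁ : 15 ≤ c₁)
    (h : ∀ v, 2 * Real.logb 2 (deg₂ G v) + c₁ ≤ ℓmax v) (v : V) :
    ∑ u ∈ nbrs G v, 2 * ((1 : ℝ) / 2) ^ ℓmax u ≤ 1 / 16384 := by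
  rcases (nbrs G v).eq_empty_or_nonempty with h0 | h0
  · simp [h0]
  have hk : (0 : ℝ) < (nbrs G v).card := by exact_mod_cast h0.card_pos
  have : ∀ u ∈ nbrs G v, 2 * ((1 : ℝ) / 2) ^ ℓmax u ≤ 1 / 16384 / (nbrs G v).card := by
    intro u hu
    have h1 : ((nbrs G v).card : ℝ) ≤ deg₂ G u := by exact_mod_cast card_nbrs_le_deg₂ hu
    have h2 : Real.logb 2 (nbrs G v).card ≤ Real.logb 2 (deg₂ G u) :=
      Real.logb_le_logb_of_le (by norm_num) hk h1
    have h3 : Real.logb 2 (nbrs G v).card + 15 ≤ ℓmax u := by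
      linarith [h u, logb_natCast_nonneg (deg₂ G u)]
    have h4 := Real.rpow_le_rpow_of_exponent_le (show (1 : ℝ) ≤ 2 by norm_num) h3
    rw [Real.rpow_add (by norm_num), Real.rpow_logb (by norm_num) (by norm_num) hk,
      Real.rpow_natCast, show (2 : ℝ) ^ (15 : ℝ) = 32768 by norm_num] at h4
    rw [one_div, inv_pow, ← div_eq_mul_inv, div_div, div_le_div_iff₀ (by positivity)
      (by positivity)]
    linarith
  refine (Finset.sum_le_card_nsmul _ _ _ this).trans_eq ?_
  rw [nsmul_eq_mul]
  field_simp

theorem union_bound_le {c₂ a K n : ℝ} {m T : ℕ} (hc₂ : 0 < c₂) (ha : 0 < a) (hn : 2 ≤ n)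
    (hm : (m : ℝ) ≤ c₂ * Real.logb 2 n) (hK : K = (c₂ + 7 + a) / decayRate)
    (hT : K * Real.logb 2 n ≤ T) :
    (1 - decayRate) ^ T * ((6 / 5) ^ m * (1 + 25 * n)) ≤ n ^ (-a - 1) := by
  have hn0 : 0 < n := by linarith
  have hη := decayRate_pos
  have hlog : 0 ≤ Real.log n := Real.log_nonneg (by linarith)
  have h1 : Real.log n ≤ Real.logb 2 n := by
    rw [Real.logb, le_div_iff₀ (Real.log_pos (by norm_num))]
    nlinarith [Real.log_two_lt_d9]
  have h2 : (1 - decayRate) ^ T ≤ n ^ (-(c₂ + 7 + a)) := by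
    calc (1 - decayRate) ^ T ≤ Real.exp (-decayRate) ^ T :=
          pow_le_pow_left₀ (by linarith [decayRate_le_one]) (Real.one_sub_le_exp_neg _) T
      _ = Real.exp (-(decayRate * T)) := by rw [← Real.exp_nat_mul]; congr 1; ring
      _ ≤ Real.exp (Real.log n * (-(c₂ + 7 + a))) := by
          refine Real.exp_le_exp.2 ?_
          have e : decayRate * (K * Real.logb 2 n) = (c₂ + 7 + a) * Real.logb 2 n := by
            rw [hK]; field_simp
          have h3 := mul_le_mul_of_nonneg_left hT hη.le
          have h4 := mul_le_mul_of_nonneg_left h1 (show 0 ≤ c₂ + 7 + a by linarith)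
          linarith
      _ = _ := (Real.rpow_def_of_pos hn0 _).symm
  have h3 : (6 / 5 : ℝ) ^ m ≤ n ^ c₂ := by
    calc (6 / 5 : ℝ) ^ m ≤ 2 ^ m := pow_le_pow_left₀ (by norm_num) (by norm_num) m
      _ = (2 : ℝ) ^ (m : ℝ) := (Real.rpow_natCast _ _).symm
      _ ≤ 2 ^ (Real.logb 2 n * c₂) :=
          Real.rpow_le_rpow_of_exponent_le (by norm_num) (by linarith)
      _ = n ^ c₂ := by
          rw [Real.rpow_mul (by norm_num), Real.rpow_logb (by norm_num) (by norm_num) hn0]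
  -- At `n = 2` this reads `51 ≤ 64`. With one further power of `n` for the union bound, it explains
  -- the 7 in `K`.
  have h4 : 1 + 25 * n ≤ n ^ (6 : ℝ) := by
    rw [show (6 : ℝ) = (6 : ℕ) by norm_num, Real.rpow_natCast]
    have := pow_le_pow_left₀ (by norm_num) hn 5
    nlinarith
  calc (1 - decayRate) ^ T * ((6 / 5) ^ m * (1 + 25 * n))
      ≤ n ^ (-(c₂ + 7 + a)) * (n ^ c₂ * n ^ (6 : ℝ)) := by gcongr
    _ = n ^ (-a - 1) := by
        rw [← Real.rpow_add hn0, ← Real.rpow_add hn0]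
        congr 1
        ring

theorem prob_not_stabilizedBy_le {c₁ c₂ a : ℝ} (hc₁ : 15 ≤ c₁) (hc₂ : 0 < c₂) (ha : 0 < a)
    (h : ∀ v, 2 * Real.logb 2 (deg₂ G v) + c₁ ≤ ℓmax v ∧
      (ℓmax v : ℝ) ≤ c₂ * Real.logb 2 (Fintype.card V))
    (hle : ∀ v, ℓ v ≤ ℓmax v) :
    randomness V {ω | ¬ StabilizedBy G ℓmax (level G ℓmax ℓ ω)
      (((c₂ + 7 + a) / decayRate + 3) * Real.logb 2 (Fintype.card V))} ≤
      ENNReal.ofReal ((Fintype.card V : ℝ) ^ (-a)) := by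
  -- Without vertices the bound `0 ^ (-a)` is 0, so the bad event has to be null.
  rcases isEmpty_or_nonempty V with hV | ⟨⟨v₀⟩⟩
  · simp [stabilizedBy_of_isEmpty]
  have h15 : ∀ v, (15 : ℝ) ≤ ℓmax v := fun v => by
    linarith [(h v).1, logb_natCast_nonneg (deg₂ G v)]
  have hpos : ∀ v, 1 < ℓmax v := fun v => by
    have := h15 v
    have : 15 ≤ ℓmax v := by exact_mod_cast this
    omega
  -- A single vertex is impossible: its maximum level would be at least 15 and at most `c₂ * 0`.
  have hn : 2 ≤ Fintype.card V := by
    by_contra hlt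
    have h1 : Fintype.card V = 1 := by
      have := Fintype.card_pos_iff.2 ⟨v₀⟩
      omega
    have := (h15 v₀).trans (h v₀).2
    rw [h1, Nat.cast_one, Real.logb_one, mul_zero] at this
    linarith
  have hn' : (2 : ℝ) ≤ Fintype.card V := by exact_mod_cast hn
  set n : ℝ := ((Fintype.card V : ℕ) : ℝ) with hndef
  set K := (c₂ + 7 + a) / decayRate with hK
  have hlog : 1 ≤ Real.logb 2 n := by
    rw [Real.le_logb_iff_rpow_le (by norm_num) (by linarith), Real.rpow_one]
    exact hn'
  have hK0 : 0 < K := div_pos (by linarith) decayRate_pos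
  set T := ⌈K * Real.logb 2 n⌉₊ with hT
  have hT1 : K * Real.logb 2 n ≤ T := Nat.le_ceil _
  have hT2 : (T : ℝ) < K * Real.logb 2 n + 1 :=
    Nat.ceil_lt_add_one (mul_nonneg hK0.le (by linarith))
  have hpos' : ∀ v, 0 < ℓmax v := fun v => zero_lt_one.trans (hpos v)
  have hsub : {ω | ¬ StabilizedBy G ℓmax (level G ℓmax ℓ ω) ((K + 3) * Real.logb 2 n)} ⊆
      ⋃ v ∈ (Finset.univ : Finset V), {ω | ¬ Dominated G (level G ℓmax ℓ ω (T + 1)) v} := by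
    intro ω hω
    by_contra hdom
    simp only [Finset.mem_univ, Set.iUnion_true, Set.mem_iUnion, Set.mem_ofPred_eq, not_exists,
      not_not] at hdom
    -- The initial round, the final settling round and the ceiling in `T` cost at most 3 in total,
    -- which `3 * Real.logb 2 n` covers because `n ≥ 2`.
    refine hω (stabilizedBy_of_dominated (B := fun t => Beep₁ ℓmax (level G ℓmax ℓ ω t) (ω t))
      (T := T + 1) hpos' (fun t => rfl) (zeroIndep_next hpos') hdom ?_)
    push_cast
    linarith
  calc randomness V _ ≤ ∑ v : V, randomness V {ω | ¬ Dominated G (level G ℓmax ℓ ω (T + 1)) v} :=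
        (measure_mono hsub).trans (measure_biUnion_finset_le _ _)
    _ ≤ ∑ _v : V, ENNReal.ofReal (n ^ (-a - 1)) := Finset.sum_le_sum fun v _ =>
        (prob_not_dominated_succ_le hpos hle
          (sum_pow_maxLevel_le hc₁ (fun v => (h v).1) v) T).trans
          (ENNReal.ofReal_le_ofReal (union_bound_le hc₂ ha hn' (h v).2 hK hT1))
    _ = ENNReal.ofReal (n ^ (-a)) := by
        rw [Finset.sum_const, nsmul_eq_mul, Finset.card_univ, ← ENNReal.ofReal_natCast,
          ← hndef, ← ENNReal.ofReal_mul (by linarith), Real.rpow_sub_one (by linarith),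
          mul_div_cancel₀ _ (by linarith)]

end TwoChannelMIS

theorem corollary3 (c₁ c₂ a : ℝ) (hc₁ : 15 ≤ c₁) (hc₂ : 0 < c₂) (ha : 0 < a) :
    ∃ M : ℝ, 0 < M ∧
      ∀ (V : Type*) [Fintype V] (G : SimpleGraph V) (ℓmax : V → ℕ),
        (∀ v, 2 * Real.logb 2 (TwoChannelMIS.deg₂ G v) + c₁ ≤ ℓmax v ∧
          (ℓmax v : ℝ) ≤ c₂ * Real.logb 2 (Fintype.card V)) →
        ∀ ℓ₀ : V → ℕ, (∀ v, ℓ₀ v ≤ ℓmax v) →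
          TwoChannelMIS.randomness V {ω | ¬ TwoChannelMIS.StabilizedBy G ℓmax
            (TwoChannelMIS.level G ℓmax ℓ₀ ω) (M * Real.logb 2 (Fintype.card V))} ≤
            ENNReal.ofReal ((Fintype.card V : ℝ) ^ (-a)) := by
  refine ⟨(c₂ + 7 + a) / TwoChannelMIS.decayRate + 3, ?_, fun V _ G ℓmax h ℓ₀ hle =>
    TwoChannelMIS.prob_not_stabilizedBy_le hc₁ hc₂ ha h hle⟩
  have := div_pos (show 0 < c₂ + 7 + a by linarith) TwoChannelMIS.decayRate_pos
  linarith
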